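/- **Theorem 3.1 (Jacobi 1).** Let $m,n\ge 1$, and let $\mathcal M$ be a positive definite symmetric integral $m\times m$ matrix with $\mathcal M\,\mathbb Z^{(m,n)}=\mathbb Z^{(m,n)}$, where $\mathbb Z^{(m,n)}$ and $\mathbb R^{(m,n)}$ denote the $m\times n$ integral and real matrices. Put $(x,y)_{\mathcal M}=\operatorname{tr}({}^tx\mathcal My)$ and $\|x\|_{\mathcal M}^2=(x,x)_{\mathcal M}$. For $g=\begin{pmatrix}a&b\\c&d\end{pmatrix}\in SL(2,\mathbb R)$ and $F:\mathbb R^{(m,n)}\to\mathbb C$ put $$[R_{\mathcal M}(g)F](x)=\begin{cases}|a|^{mn/2}e^{\pi i\,ab\|x\|_{\mathcal M}^2}F(ax)&(c=0),\\ (\det\mathcal M)^{n/2}|c|^{-mn/2}\displaystyle\int_{\mathbb R^{(m,n)}}e^{\pi i\,(a\|x\|_{\mathcal M}^2+d\|y\|_{\mathcal M}^2-2(x,y)_{\mathcal M})/c}F(y)\,dy&(c\ne0).\end{cases}$$ For $\tau=u+iv$ with $v>0$ and $\phi\in\mathbb R$ (which matters only modulo $2\pi$) let $$(\tau,\phi)=\begin{pmatrix}1&u\\0&1\end{pmatrix}\begin{pmatrix}v^{1/2}&0\\0&v^{-1/2}\end{pmatrix}\begin{pmatrix}\cos\phi&-\sin\phi\\\sin\phi&\cos\phi\end{pmatrix}\in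 SL(2,\mathbb R).$$ For a Schwartz function $f$ on $\mathbb R^{(m,n)}$, for $\lambda,\mu\in\mathbb R^{(m,n)}$, and for $\kappa\in\mathbb R^{(m,m)}$ with $\kappa+\mu\,{}^t\lambda$ symmetric, define the theta sum $$\Theta_f^{[\mathcal M]}(\tau,\phi;\lambda,\mu,\kappa)=\sum_{\omega\in\mathbb Z^{(m,n)}}e^{\pi i\operatorname{tr}(\mathcal M(\kappa+\mu\,{}^t\lambda+2\omega\,{}^t\mu))}\,[R_{\mathcal M}(\tau,\phi)f](\omega+\lambda).$$ For $g_1,g_2\in SL(2,\mathbb R)$ let $c_{\mathcal M}(g_1,g_2)=e^{-i\pi mn\,\operatorname{sign}(c_1c_2c_3)/4}$, where $c_1,c_2,c_3$ are the lower left entries of $g_1,g_2,g_1g_2$ and $\operatorname{sign}(0)=0$. Let $S=\begin{pmatrix}0&-1\\1&0\end{pmatrix}$, and let $\arg\tau\in(0,\pi)$. Then the series $\Theta_f^{[\mathcal M]}(\tau,\phi;\lambda,\mu,\kappa)$ and $\Theta_f^{[\mathcal M]}(-\tfrac1\tau,\phi+\arg\tau;-\mu,\lambda,\kappa)$ converge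 absolutely, and $$\Theta_f^{[\mathcal M]}\Big(-\frac1\tau,\ \phi+\arg\tau;\ -\mu,\lambda,\kappa\Big)=(\det\mathcal M)^{-n/2}\,c_{\mathcal M}(S,(\tau,\phi))\,\Theta_f^{[\mathcal M]}(\tau,\phi;\lambda,\mu,\kappa),$$ where $$c_{\mathcal M}(S,(\tau,\phi))=e^{-i\pi mn\,\operatorname{sign}(\sin\phi\,\sin(\phi+\arg\tau))/4}.$$ Moreover $R_{\mathcal M}(S\cdot(\tau,\phi))f=c_{\mathcal M}(S,(\tau,\phi))\,R_{\mathcal M}(S)R_{\mathcal M}(\tau,\phi)f$ pointwise. -/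

import Mathlib

open scoped SchwartzMap MatrixGroups UpperHalfPlane

/- The entrywise sup norm on real matrices; it is used only to speak of Schwartz functions on the
finite-dimensional space of `m × n` matrices (any other norm gives the same functions). -/
attribute [local instance] Matrix.normedAddCommGroup Matrix.normedSpace

noncomputable section

namespace ThetaSum

variable {m n : ℕ}

/-- The bilinear form `(x, y)_M = tr (ᵗx M y)` on real `m × n` matrices. -/
def form (M : Matrix (Fin m) (Fin m) ℝ) (x y : Matrix (Fin m) (Fin n) ℝ) : ℝ :=
  (x.transpose * M * y).trace

/-- The matrix `S = (0 -1; 1 0)` in `SL(2, ℝ)`. -/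
def matS : SL(2, ℝ) := ⟨!![0, -1; 1, 0], by simp [Matrix.det_fin_two]⟩

/-- The element `(τ, φ)` of `SL(2, ℝ)`, with `τ = u + i v`, in Iwasawa coordinates. The angle `φ`
is a real number; the element depends on it only modulo `2π`. -/
def iwasawa (τ : ℍ) (φ : ℝ) : SL(2, ℝ) :=
  ⟨!![1, τ.re; 0, 1] * !![Real.sqrt τ.im, 0; 0, (Real.sqrt τ.im)⁻¹] *
      !![Real.cos φ, -Real.sin φ; Real.sin φ, Real.cos φ], by
    have h : Real.sqrt τ.im ≠ 0 := (Real.sqrt_pos.2 τ.im_pos).ne'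
    rw [Matrix.det_mul, Matrix.det_mul]
    simp only [Matrix.det_fin_two_of]
    have h2 := mul_inv_cancel₀ h
    have h3 := Real.cos_sq_add_sin_sq φ
    rw [h2]
    linarith⟩

/-- The point `-1/τ` of the upper half plane. -/
def negInv (τ : ℍ) : ℍ :=
  ⟨-1 / (τ : ℂ), by
    have h := τ.im_inv_neg_coe_pos
    rwa [← neg_inv, ← one_div, ← neg_div] at h⟩

/-- The Schrödinger representation of the Heisenberg group:
`[W(λ, μ; κ) F](x) = exp(π i tr(M (κ + μ ᵗλ + 2 x ᵗμ))) F(x + λ)`. -/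
def schrodinger (M : Matrix (Fin m) (Fin m) ℝ) (lam mu : Matrix (Fin m) (Fin n) ℝ)
    (kap : Matrix (Fin m) (Fin m) ℝ) (F : Matrix (Fin m) (Fin n) ℝ → ℂ)
    (x : Matrix (Fin m) (Fin n) ℝ) : ℂ :=
  Complex.exp ((Real.pi : ℂ) * Complex.I *
      (((M * (kap + mu * lam.transpose + (2 : ℝ) • (x * mu.transpose))).trace : ℝ) : ℂ)) *
    F (x + lam)

/-- The projective representation `R_M` of `SL(2, ℝ)` (embedded in `Sp(n, ℝ)` by scalar blocks) on
functions of a real `m × n` matrix. The integral is with respect to Lebesgue measure on the `m n`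
matrix entries. -/
def weilR (M : Matrix (Fin m) (Fin m) ℝ) (g : SL(2, ℝ)) (F : Matrix (Fin m) (Fin n) ℝ → ℂ)
    (x : Matrix (Fin m) (Fin n) ℝ) : ℂ :=
  if g 1 0 = 0 then
    ((|g 0 0| ^ ((m : ℝ) * n / 2) : ℝ) : ℂ) *
      Complex.exp ((Real.pi : ℂ) * Complex.I * ((g 0 0 * g 0 1 * form M x x : ℝ) : ℂ)) *
      F (g 0 0 • x)
  else
    ((M.det ^ ((n : ℝ) / 2) * |g 1 0| ^ (-((m : ℝ) * n / 2)) : ℝ) : ℂ) *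
      ∫ y : Fin m → Fin n → ℝ,
        Complex.exp ((Real.pi : ℂ) * Complex.I *
          (((g 0 0 * form M x x + g 1 1 * form M (Matrix.of y) (Matrix.of y)
              - 2 * form M x (Matrix.of y)) / g 1 0 : ℝ) : ℂ)) * F (Matrix.of y)

/-- The cocycle `c_M(g₁, g₂) = exp(-i π m n sign(c₁ c₂ c₃) / 4)` on `SL(2, ℝ)`, where `c₁, c₂, c₃`
are the lower left entries of `g₁`, `g₂`, `g₁ g₂`. -/
def cocycle (m n : ℕ) (g₁ g₂ : SL(2, ℝ)) : ℂ :=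
  Complex.exp (-(Complex.I * (Real.pi : ℂ) * (m : ℂ) * (n : ℂ) *
    ((Real.sign (g₁ 1 0 * g₂ 1 0 * (g₁ * g₂) 1 0) : ℝ) : ℂ)) / 4)

/-- The term `[π_M((λ, μ; κ)(τ, φ)) f](ω) = [W(λ, μ; κ) R_M(τ, φ) f](ω)` of the theta sum. -/
def thetaTerm (M : Matrix (Fin m) (Fin m) ℝ) (f : 𝓢(Matrix (Fin m) (Fin n) ℝ, ℂ))
    (τ : ℍ) (φ : ℝ) (lam mu : Matrix (Fin m) (Fin n) ℝ) (kap : Matrix (Fin m) (Fin m) ℝ)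
    (ω : Matrix (Fin m) (Fin n) ℤ) : ℂ :=
  schrodinger M lam mu kap (weilR M (iwasawa τ φ) f) (ω.map (Int.cast : ℤ → ℝ))

/-- The theta sum `Θ_f^{[M]}(τ, φ; λ, μ, κ)`, a sum over all integral `m × n` matrices. -/
def theta (M : Matrix (Fin m) (Fin m) ℝ) (f : 𝓢(Matrix (Fin m) (Fin n) ℝ, ℂ))
    (τ : ℍ) (φ : ℝ) (lam mu : Matrix (Fin m) (Fin n) ℝ) (kap : Matrix (Fin m) (Fin m) ℝ) : ℂ :=
  ∑' ω : Matrix (Fin m) (Fin n) ℤ, thetaTerm M f τ φ lam mu kap ω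

end ThetaSum

end

/-!
The transformation formula is Poisson summation combined with the relation
`R_M(S g) = c_M(S, g) R_M(S) R_M(g)` for the projective representation.

Write `M = ᵗB B`. In the coordinates `x ↦ B x` the form of `M` becomes the Euclidean inner
product, and the factor `(det M) ^ (n / 2)` in `R_M` is the Jacobian
(`exists_isometric_coordinates`, `weilR_apply_isometric`). It is then enough to study the
operators `R(g)` on a Euclidean space. For `c ≠ 0` such an operator is composed of multiplications
by chirps `exp(π i t ‖x‖²)`, a dilation and the Fourier transform, so it preserves Schwartz
functions; `R(S)` is the Fourier transform itself. The composition formula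
`weilStd_eq_fourier_weilStd` is a change of variables if `c = 0`, Fourier inversion if `a = 0`,
and otherwise the Fresnel integral `fourier_chirp_mul_fourier`, where the root of unity
`exp(i π m n sign(a c) / 4)` appears as the limit of the Gaussian factor
`(1 / (ε - i t)) ^ (m n / 2)` with `t = a c`.

The theta sum is the sum over integral `ω` of `H(ω)`, where `H = W(λ, μ; κ) R_M(τ, φ) f` is a
Schwartz function; in particular it converges absolutely. Since `S (τ, φ) = (-1/τ, φ + arg τ)`
(`matS_mul_iwasawa`) and `R_M(S) W(λ, μ; κ) = W(-μ, λ; κ) R_M(S)` (`weilR_matS_schrodinger`), the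
transformed theta sum is `c_M(S, (τ, φ))` times the sum of `R_M(S) H` over the lattice. As `M` is
unimodular and positive definite, `det M = 1`, and `R_M(S) H` at `ω` is the Fourier transform of
`H` at `M ω`, where `M ω` runs through the lattice. Poisson summation (`tsum_eq_tsum_fourier`)
finishes the proof; it is obtained from the Fourier series on the torus of the periodization of
`H`.
-/

namespace ThetaSum

open MeasureTheory Complex Filter FourierTransform
open scoped RealInnerProductSpace Topology

/-! ### Chirps and the Fresnel integral -/

section Fresnel

theorem iteratedDeriv_cexp_ofReal_mul_I (k : ℕ) :
    iteratedDeriv k (fun s : ℝ => cexp (s * I)) = fun s : ℝ => I ^ k * cexp (s * I) := by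
  induction k with
  | zero => simp
  | succ k ih =>
    rw [iteratedDeriv_succ, ih]
    ext s
    have h : HasDerivAt (fun s : ℝ => I ^ k * cexp (s * I)) (I ^ k * (cexp (s * I) * (1 * I))) s :=
      (((hasDerivAt_id _).ofReal_comp.mul_const I).cexp.const_mul (I ^ k))
    rw [h.deriv]
    ring

theorem hasTemperateGrowth_cexp_ofReal_mul_I :
    Function.HasTemperateGrowth (fun s : ℝ => cexp (s * I)) := by
  refine ⟨(Complex.ofRealCLM.contDiff.mul contDiff_const).cexp, fun k => ⟨0, 1, fun s => ?_⟩⟩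
  rw [norm_iteratedFDeriv_eq_norm_iteratedDeriv, iteratedDeriv_cexp_ofReal_mul_I]
  simp [Complex.norm_exp_ofReal_mul_I]

section Chirp

variable {V : Type*} [NormedAddCommGroup V]

/-- The chirp `x ↦ exp(π i t ‖x‖²)`, the unimodular Gaussian of real parameter `t`. -/
noncomputable def chirp (t : ℝ) (x : V) : ℂ :=
  cexp (Real.pi * I * ((t * ‖x‖ ^ 2 : ℝ) : ℂ))

@[simp] theorem chirp_zero_left (x : V) : chirp 0 x = 1 := by simp [chirp]

end Chirp

variable {V : Type*} [NormedAddCommGroup V] [InnerProductSpace ℝ V]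

theorem hasTemperateGrowth_chirp (t : ℝ) : (chirp t : V → ℂ).HasTemperateGrowth := by
  have h : (fun x : V => (Real.pi * t) * ‖x‖ ^ 2).HasTemperateGrowth :=
    (Function.HasTemperateGrowth.const _).mul (Function.hasTemperateGrowth_norm_sq V)
  have := hasTemperateGrowth_cexp_ofReal_mul_I.comp h
  refine (congrArg Function.HasTemperateGrowth ?_).mp this
  ext x
  simp only [chirp, Function.comp]
  congr 1
  push_cast
  ring

theorem chirp_smul (t a : ℝ) (x : V) : chirp t (a • x) = chirp (t * a ^ 2) x := by
  simp only [chirp, norm_smul, mul_pow, Real.norm_eq_abs, sq_abs]; congr 3; ring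

/-- Multiplication by `chirp t` as an operator on Schwartz functions; it is one because all
derivatives of a chirp grow at most polynomially. -/
noncomputable def chirpMul (t : ℝ) : 𝓢(V, ℂ) →L[ℂ] 𝓢(V, ℂ) := SchwartzMap.smulLeftCLM ℂ (chirp t)

@[simp] theorem chirpMul_apply (t : ℝ) (F : 𝓢(V, ℂ)) (x : V) :
    chirpMul t F x = chirp t x * F x :=
  SchwartzMap.smulLeftCLM_apply_apply (hasTemperateGrowth_chirp t) F x

theorem coe_chirpMul (t : ℝ) (F : 𝓢(V, ℂ)) : ⇑(chirpMul t F) = fun x => chirp t x * F x :=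
  funext (chirpMul_apply t F)

/-- The dilation `F ↦ F (a • ·)` of Schwartz functions, for `a ≠ 0`. -/
noncomputable def dilate (a : ℝ) (ha : a ≠ 0) : 𝓢(V, ℂ) →L[ℂ] 𝓢(V, ℂ) :=
  SchwartzMap.compCLMOfContinuousLinearEquiv ℂ (ContinuousLinearEquiv.smulLeft (Units.mk0 a ha))

@[simp] theorem dilate_apply (a : ℝ) (ha : a ≠ 0) (F : 𝓢(V, ℂ)) (x : V) :
    dilate a ha F x = F (a • x) := rfl

variable [FiniteDimensional ℝ V] [MeasurableSpace V] [BorelSpace V]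

theorem fourier_comp_smul (F : V → ℂ) (a : ℝ) (ha : a ≠ 0) (w : V) :
    𝓕 (fun x => F (a • x)) w = (|a| ^ (-(Module.finrank ℝ V : ℝ)) : ℝ) * 𝓕 F (a⁻¹ • w) := by
  simp only [Real.fourier_eq']
  have := Measure.integral_comp_smul (volume : Measure V)
    (fun y => cexp (((-2 * Real.pi * ⟪y, a⁻¹ • w⟫ : ℝ) : ℂ) * I) • F y) a
  have e (x : V) : a⁻¹ * (a * ⟪x, w⟫) = ⟪x, w⟫ := inv_mul_cancel_left₀ ha _
  simp only [inner_smul_left, inner_smul_right, conj_trivial, e] at this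
  rw [this, Real.rpow_neg (abs_nonneg a), Real.rpow_natCast, abs_inv, abs_pow, real_smul]
  simp only [inner_smul_right]

/-- The source of the eighth roots of unity: the principal value of `(1 / (-i t)) ^ (N / 2)` is
`|t| ^ (-N / 2)` times `exp(i π N sign(t) / 4)`. -/
theorem one_div_neg_mul_I_cpow_half {t : ℝ} (ht : t ≠ 0) (N : ℕ) :
    (1 / (-(t : ℂ) * I)) ^ ((N : ℂ) / 2) =
      (|t| ^ (-((N : ℝ) / 2)) : ℝ) * cexp (I * Real.pi * N * (Real.sign t : ℝ) / 4) := by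
  -- `1 / (-i t)` is a positive real number times `±i`, whose principal logarithm is `±π i / 2`.
  have key : (1 / (-(t : ℂ) * I)) = ((|t|⁻¹ : ℝ) : ℂ) * ((Real.sign t : ℝ) * I) := by
    rcases lt_or_gt_of_ne ht with h | h
    · rw [abs_of_neg h, Real.sign_of_neg h]
      have : (t : ℂ) ≠ 0 := by exact_mod_cast ht
      push_cast; field_simp; simp
    · rw [abs_of_pos h, Real.sign_of_pos h]
      have : (t : ℂ) ≠ 0 := by exact_mod_cast ht
      push_cast; field_simp; simp
  have hlog : Complex.log (((Real.sign t : ℝ) : ℂ) * I) = Real.pi / 2 * (Real.sign t : ℝ) * I := by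
    rcases lt_or_gt_of_ne ht with h | h
    · rw [Real.sign_of_neg h]; simp [Complex.log_neg_I]
    · rw [Real.sign_of_pos h]; simp [Complex.log_I]
  have hs : ((Real.sign t : ℝ) : ℂ) * I ≠ 0 := by
    simp [Real.sign_eq_zero_iff, ht]
  have hpos : 0 < |t| := abs_pos.2 ht
  rw [key, cpow_def_of_ne_zero (mul_ne_zero (by simpa using ht) hs),
    Complex.log_ofReal_mul (inv_pos.2 hpos) hs, hlog, Real.log_inv, Real.rpow_def_of_pos hpos,
    ofReal_exp, ← Complex.exp_add]
  congr 1
  push_cast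
  ring

/-- Self-adjointness of the Fourier transform moves it from `k` to a Gaussian of complex parameter
`b` with positive real part, whose transform is known in closed form. -/
theorem integral_gaussian_mul_fourier (k : 𝓢(V, ℂ)) (w : V) {b : ℂ} (hb : 0 < b.re) :
    ∫ y, cexp (-(Real.pi * b) * ‖y‖ ^ 2 + 2 * Real.pi * I * ⟪-w, y⟫) * 𝓕 k y =
      (1 / b) ^ ((Module.finrank ℝ V : ℂ) / 2) *
        ∫ z, cexp (-Real.pi * ‖w + z‖ ^ 2 * (1 / b)) * k z := by
  have hb' : 0 < ((Real.pi : ℂ) * b).re := by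
    rw [re_ofReal_mul]; exact mul_pos Real.pi_pos hb
  have hb0 : b ≠ 0 := by rintro rfl; simp at hb
  have hpi : (Real.pi : ℂ) ≠ 0 := by exact_mod_cast Real.pi_ne_zero
  have hint : Integrable
      (fun y : V => cexp (-(Real.pi * b) * ‖y‖ ^ 2 + 2 * Real.pi * I * ⟪-w, y⟫)) :=
    GaussianFourier.integrable_cexp_neg_mul_sq_norm_add hb' _ _
  have h := VectorFourier.integral_bilin_fourierIntegral_eq_flip (ContinuousLinearMap.mul ℂ ℂ)
    (L := innerₗ V) (μ := volume) (ν := volume) Real.continuous_fourierChar continuous_inner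
    hint k.integrable
  simp only [flip_innerₗ] at h
  refine Eq.trans (Eq.trans ?_ h.symm) ?_
  · rfl
  · rw [← integral_const_mul]
    congr 1
    ext z
    have h2 := fourier_gaussian_innerProductSpace' hb' (-w) z
    rw [ContinuousLinearMap.mul_apply']
    refine (congrArg (· * k z) h2).trans ?_
    rw [mul_assoc]
    have e1 : (Real.pi : ℂ) / (Real.pi * b) = 1 / b := by field_simp
    have e2 : ‖-w - z‖ = ‖w + z‖ := by rw [← norm_neg]; congr 1; abel
    rw [e1, e2]
    congr 3
    field_simp

/-- The Fresnel integral: the Fourier transform of a chirp times `𝓕 k` is the convolution type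
integral of `k` against the inverse chirp. It is the limit of `integral_gaussian_mul_fourier` along
`b = ε - i t`, as `ε` decreases to `0`; the chirp itself is not integrable, but Schwartz functions
dominate both sides. -/
theorem fourier_chirp_mul_fourier (k : 𝓢(V, ℂ)) {t : ℝ} (ht : t ≠ 0) (w : V) :
    𝓕 (fun y => chirp t y * 𝓕 k y) w =
      (|t| ^ (-((Module.finrank ℝ V : ℝ) / 2)) : ℝ) *
        cexp (I * Real.pi * (Module.finrank ℝ V : ℕ) * (Real.sign t : ℝ) / 4) *
        ∫ z, chirp (-t⁻¹) (w + z) * k z := by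
  set b : ℝ → ℂ := fun ε => ε - t * I with hbdef
  have hb : ∀ ε, (b ε).re = ε := fun ε => by simp [hbdef]
  have hcont : Tendsto b (𝓝[>] 0) (𝓝 (-(t : ℂ) * I)) := by
    have : Continuous b := by fun_prop
    have h := this.tendsto 0
    simp only [hbdef, ofReal_zero, zero_sub] at h
    rw [neg_mul]
    exact h.mono_left nhdsWithin_le_nhds
  have hne : -(t : ℂ) * I ≠ 0 := by simpa using ht
  have hinv : Tendsto (fun ε => 1 / b ε) (𝓝[>] 0) (𝓝 (1 / (-(t : ℂ) * I))) :=
    tendsto_const_nhds.div hcont hne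
  have hpos : ∀ᶠ ε : ℝ in 𝓝[>] 0, 0 < ε := eventually_mem_nhdsWithin
  have hl : Tendsto (fun ε => ∫ y, cexp (-(Real.pi * b ε) * ‖y‖ ^ 2 +
      2 * Real.pi * I * ⟪-w, y⟫) * 𝓕 k y) (𝓝[>] 0) (𝓝 (𝓕 (fun y => chirp t y * 𝓕 k y) w)) := by
    have e : 𝓕 (fun y => chirp t y * 𝓕 k y) w = ∫ y, cexp (-(Real.pi * (-(t : ℂ) * I)) * ‖y‖ ^ 2 +
      2 * Real.pi * I * ⟪-w, y⟫) * 𝓕 k y := by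
      rw [Real.fourier_eq']
      congr 1
      ext y
      simp only [chirp, smul_eq_mul]
      rw [← mul_assoc, ← Complex.exp_add]
      congr 2
      rw [inner_neg_left, real_inner_comm]
      push_cast
      ring
    rw [e]
    refine tendsto_integral_filter_of_dominated_convergence (fun y => ‖𝓕 k y‖) ?_ ?_ ?_ ?_
    · refine Eventually.of_forall fun ε => Continuous.aestronglyMeasurable ?_
      have := (𝓕 k).continuous
      fun_prop
    · filter_upwards [hpos] with ε hε
      refine Eventually.of_forall fun y => ?_
      rw [norm_mul, Complex.norm_exp]
      refine mul_le_of_le_one_left (norm_nonneg _) (Real.exp_le_one_iff.2 ?_)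
      have : (-(Real.pi * b ε) * ‖y‖ ^ 2 + 2 * Real.pi * I * ⟪-w, y⟫).re
          = -(Real.pi * ε * ‖y‖ ^ 2) := by
        simp [← ofReal_pow, hb]
      rw [this]
      have := Real.pi_pos
      simp only [Left.neg_nonpos_iff]
      positivity
    · exact (𝓕 k).integrable.norm
    · refine Eventually.of_forall fun y => Tendsto.mul_const _ ?_
      refine (Complex.continuous_exp.tendsto _).comp ?_
      exact (((hcont.const_mul _).neg).mul_const _).add_const _
  have hr : Tendsto (fun ε => (1 / b ε) ^ ((Module.finrank ℝ V : ℂ) / 2) *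
        ∫ z, cexp (-Real.pi * ‖w + z‖ ^ 2 * (1 / b ε)) * k z) (𝓝[>] 0)
      (𝓝 ((1 / (-(t : ℂ) * I)) ^ ((Module.finrank ℝ V : ℂ) / 2) *
        ∫ z, cexp (-Real.pi * ‖w + z‖ ^ 2 * (1 / (-(t : ℂ) * I))) * k z)) := by
    refine Tendsto.mul ?_ ?_
    · refine hinv.cpow tendsto_const_nhds ?_
      right
      rw [one_div, neg_mul, inv_neg, mul_inv, inv_I]
      simp [← ofReal_inv, ht]
    · refine tendsto_integral_filter_of_dominated_convergence (fun y => ‖k y‖) ?_ ?_ ?_ ?_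
      · refine Eventually.of_forall fun ε => Continuous.aestronglyMeasurable ?_
        have := k.continuous
        fun_prop
      · filter_upwards [hpos] with ε hε
        refine Eventually.of_forall fun y => ?_
        rw [norm_mul, Complex.norm_exp]
        refine mul_le_of_le_one_left (norm_nonneg _) (Real.exp_le_one_iff.2 ?_)
        have h1 : 0 ≤ (1 / b ε).re := by
          rw [one_div, inv_re, hb]
          exact div_nonneg hε.le (normSq_nonneg _)
        have : (-Real.pi * ‖w + y‖ ^ 2 * (1 / b ε)).re =
            -(Real.pi * ‖w + y‖ ^ 2 * (1 / b ε).re) := by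
          rw [← re_ofReal_mul, ← neg_re]
          congr 1
          push_cast
          ring
        rw [this]
        have := Real.pi_pos
        simp only [Left.neg_nonpos_iff]
        positivity
      · exact k.integrable.norm
      · refine Eventually.of_forall fun y => Tendsto.mul_const _ ?_
        exact (Complex.continuous_exp.tendsto _).comp (hinv.const_mul _)
  have heq := tendsto_nhds_unique (hl.congr' (by
    filter_upwards [hpos] with ε hε
    exact integral_gaussian_mul_fourier k w (by rwa [hb]))) hr
  rw [heq, one_div_neg_mul_I_cpow_half ht]
  congr 2
  ext z
  congr 1
  simp only [chirp]
  congr 1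
  have : (t : ℂ) ≠ 0 := by exact_mod_cast ht
  push_cast
  field_simp
  simp

end Fresnel

/-! ### The projective representation on an inner product space -/

section WeilOperator

variable {V : Type*} [NormedAddCommGroup V] [InnerProductSpace ℝ V] [FiniteDimensional ℝ V]
  [MeasurableSpace V] [BorelSpace V]

/-- The operator `R(g)`, for `g = (a b; c d)`, on functions on a Euclidean space, defined as in
`weilR` with the inner product in place of the form of `M`. It takes the four entries of `g`
as arguments. -/
noncomputable def weilStd (a b c d : ℝ) (F : V → ℂ) (x : V) : ℂ :=
  if c = 0 then
    (|a| ^ ((Module.finrank ℝ V : ℝ) / 2) : ℝ) * chirp (a * b) x * F (a • x)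
  else
    (|c| ^ (-((Module.finrank ℝ V : ℝ) / 2)) : ℝ) *
      ∫ y, cexp (Real.pi * I * (((a * ‖x‖ ^ 2 + d * ‖y‖ ^ 2 - 2 * ⟪x, y⟫) / c : ℝ) : ℂ)) * F y

theorem weilStd_of_eq_zero {a b c d : ℝ} (hc : c = 0) (F : V → ℂ) (x : V) :
    weilStd a b c d F x =
      (|a| ^ ((Module.finrank ℝ V : ℝ) / 2) : ℝ) * chirp (a * b) x * F (a • x) :=
  if_pos hc

/-- For `c ≠ 0`, `R(g)` is a chirp, a Fourier transform, a dilation and another chirp in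
succession. -/
theorem weilStd_of_ne_zero {a b c d : ℝ} (hc : c ≠ 0) (F : V → ℂ) (x : V) :
    weilStd a b c d F x = (|c| ^ (-((Module.finrank ℝ V : ℝ) / 2)) : ℝ) *
      (chirp (a / c) x * 𝓕 (fun y => chirp (d / c) y * F y) (c⁻¹ • x)) := by
  rw [weilStd, if_neg hc, Real.fourier_eq', ← integral_const_mul (chirp (a / c) x)]
  congr 1
  refine integral_congr_ae (Eventually.of_forall fun y => ?_)
  simp only [chirp, smul_eq_mul]
  rw [← mul_assoc, ← mul_assoc, ← Complex.exp_add, ← Complex.exp_add, inner_smul_right,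
    real_inner_comm]
  congr 2
  have : (c : ℂ) ≠ 0 := by exact_mod_cast hc
  push_cast
  field_simp
  ring

/-- `R(S)` is the Fourier transform. -/
theorem weilStd_zero_neg_one_one_zero (F : V → ℂ) : weilStd 0 (-1) 1 0 F = 𝓕 F := by
  ext x
  rw [weilStd_of_ne_zero one_ne_zero]
  simp

theorem exists_schwartzMap_eq_weilStd {a b c d : ℝ} (hdet : a * d - b * c = 1) (F : 𝓢(V, ℂ)) :
    ∃ G : 𝓢(V, ℂ), ⇑G = weilStd a b c d F := by
  by_cases hc : c = 0
  · have ha : a ≠ 0 := by rintro rfl; simp [hc] at hdet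
    refine ⟨((|a| ^ ((Module.finrank ℝ V : ℝ) / 2) : ℝ) : ℂ) •
      chirpMul (a * b) (dilate a ha F), ?_⟩
    ext x
    simp [weilStd_of_eq_zero hc, mul_assoc]
  · refine ⟨((|c| ^ (-((Module.finrank ℝ V : ℝ) / 2)) : ℝ) : ℂ) •
      chirpMul (a / c) (dilate c⁻¹ (inv_ne_zero hc) (𝓕 (chirpMul (d / c) F))), ?_⟩
    ext x
    simp [weilStd_of_ne_zero hc, SchwartzMap.fourier_coe, coe_chirpMul]

theorem fourier_fourier (k : 𝓢(V, ℂ)) (w : V) : 𝓕 (𝓕 k) w = k (-w) := by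
  have h := Real.fourierInv_eq_fourier_neg (𝓕 (k : V → ℂ)) (-w)
  rw [neg_neg] at h
  rw [SchwartzMap.fourier_coe, SchwartzMap.fourier_coe, ← h, ← SchwartzMap.fourier_coe,
    ← SchwartzMap.fourierInv_coe, FourierTransform.fourierInv_fourier_eq]

theorem fourier_const_mul (c : ℂ) (h : V → ℂ) (w : V) :
    𝓕 (fun x => c * h x) w = c * 𝓕 h w := by
  simp only [Real.fourier_eq', smul_eq_mul]
  rw [← integral_const_mul]
  congr 1
  ext y
  ring

/-- The relation `R(S g) = c(S, g) R(S) R(g)`, where `S g = (-c -d; a b)`. It is a change of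
variables for `c = 0`, Fourier inversion for `a = 0`, and the Fresnel integral with `t = a c`
otherwise; only the last case contributes a nontrivial root of unity. -/
theorem weilStd_eq_fourier_weilStd {a b c d : ℝ} (hdet : a * d - b * c = 1) (F : 𝓢(V, ℂ)) (x : V) :
    weilStd (-c) (-d) a b F x =
      cexp (-(I * Real.pi * (Module.finrank ℝ V : ℕ) * (Real.sign (c * a) : ℝ)) / 4) *
        𝓕 (weilStd a b c d F) x := by
  set N : ℝ := (Module.finrank ℝ V : ℝ) with hN
  by_cases hc : c = 0
  · have ha : a ≠ 0 := by rintro rfl; simp [hc] at hdet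
    have hg : weilStd a b c d F = fun x => ((|a| ^ (N / 2) : ℝ) : ℂ) *
        chirpMul (b / a) F (a • x) := by
      ext x
      rw [weilStd_of_eq_zero hc, mul_assoc, chirpMul_apply, chirp_smul,
        show b / a * a ^ 2 = a * b by field_simp]
    rw [weilStd_of_ne_zero ha, hg, fourier_const_mul, fourier_comp_smul _ _ ha, 
      ← mul_assoc ((|a| ^ (N / 2) : ℝ) : ℂ), ← ofReal_mul, ← Real.rpow_add (abs_pos.2 ha), ← hN,
      show N / 2 + -N = -(N / 2) by ring,
      coe_chirpMul, hc]
    simp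
  have hc' : 0 < |c| := abs_pos.2 hc
  -- For `c ≠ 0`, `𝓕 (R(g) F)` is, up to a scalar, a dilate of `𝓕 (chirp (a c) * 𝓕 k)`.
  set k := chirpMul (d / c) F with hk
  have hg : weilStd a b c d F = fun x => ((|c| ^ (-(N / 2)) : ℝ) : ℂ) *
      chirpMul (a * c) (𝓕 k) (c⁻¹ • x) := by
    ext x
    rw [weilStd_of_ne_zero hc, ← hN, chirpMul_apply, chirp_smul,
      show a * c * c⁻¹ ^ 2 = a / c by field_simp, hk, SchwartzMap.fourier_coe, coe_chirpMul]
  have hcc : |c⁻¹| ^ (-N) = |c| ^ N := by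
    rw [abs_inv, Real.inv_rpow hc'.le, Real.rpow_neg hc'.le, inv_inv]
  rw [hg, fourier_const_mul, fourier_comp_smul _ _ (inv_ne_zero hc), inv_inv, ← hN, hcc,
    ← mul_assoc ((|c| ^ (-(N / 2)) : ℝ) : ℂ), ← ofReal_mul, ← Real.rpow_add hc',
    show -(N / 2) + N = N / 2 by ring]
  by_cases ha : a = 0
  · have hz : chirpMul (a * c) (𝓕 k) = 𝓕 k := by ext; simp [ha]
    rw [weilStd_of_eq_zero ha, hz, ← SchwartzMap.fourier_coe, fourier_fourier, hk, chirpMul_apply,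
      ← neg_smul, chirp_smul, ha, show -c * -d = d / c * (-c) ^ 2 by field_simp]
    simp [mul_assoc, hN]
  · have ha' : 0 < |a| := abs_pos.2 ha
    have hac : a * c ≠ 0 := mul_ne_zero ha hc
    rw [coe_chirpMul, fourier_chirp_mul_fourier k hac, weilStd, if_neg ha]
    have hint : ∀ z, chirp (-(a * c)⁻¹) (c • x + z) * k z =
        cexp (Real.pi * I *
        (((-c * ‖x‖ ^ 2 + b * ‖z‖ ^ 2 - 2 * ⟪x, z⟫) / a : ℝ) : ℂ)) * F z := by
      intro z
      rw [hk, chirpMul_apply, ← mul_assoc]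
      simp only [chirp]
      rw [← Complex.exp_add, ← mul_add, ← ofReal_add]
      congr 4
      rw [norm_add_sq_real, inner_smul_left, norm_smul, mul_pow, Real.norm_eq_abs, sq_abs]
      have hb : b = (a * d - 1) / c := by
        field_simp
        linarith
      rw [hb]
      simp only [conj_trivial]
      field_simp
      ring
    simp only [hint]
    have hconst : |c| ^ (N / 2) * |a * c| ^ (-(N / 2)) = |a| ^ (-(N / 2)) := by
      rw [abs_mul, Real.mul_rpow ha'.le hc'.le, mul_left_comm, ← Real.rpow_add hc']
      simp
    rw [← hN, ← hconst, ofReal_mul, mul_comm c a, neg_div, Complex.exp_neg]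
    have := Complex.exp_ne_zero (I * Real.pi * (Module.finrank ℝ V : ℕ) *
      (Real.sign (a * c) : ℝ) / 4)
    field_simp

end WeilOperator

/-! ### Poisson summation for Schwartz functions in several variables -/

section Poisson

variable {ι : Type*}

/-- An integer vector, regarded as a real vector. -/
noncomputable def intVec (ω : ι → ℤ) : ι → ℝ := fun i => ω i

@[simp] theorem intVec_apply (ω : ι → ℤ) (i : ι) : intVec ω i = ω i := rfl

variable [Fintype ι]

theorem summable_one_add_norm_intVec :
    Summable fun ω : ι → ℤ => (1 + ‖intVec ω‖)⁻¹ ^ (Fintype.card ι + 1) := by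
  set b := (Pi.basisFun ℝ ι).restrictScalars ℤ with hb
  have hrank : Module.finrank ℤ (Submodule.span ℤ (Set.range (Pi.basisFun ℝ ι))) =
      Fintype.card ι := Module.finrank_eq_card_basis b
  have h := ZLattice.summable_norm_pow_inv
    (Submodule.span ℤ (Set.range (Pi.basisFun ℝ ι))) (Fintype.card ι + 1) (by omega)
  have h2 := (b.equivFun.symm.toEquiv.summable_iff).2 h
  have hcoe : ∀ ω : ι → ℤ, ‖b.equivFun.symm ω‖ = ‖intVec ω‖ := by
    intro ω
    rw [Submodule.coe_norm]
    congr 1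
    rw [Module.Basis.equivFun_symm_apply]
    ext i
    classical simp [hb, Pi.basisFun_apply, Pi.single_apply]
  -- The comparison fails at `ω = 0`, where the term of `h2` is the junk value `0⁻¹ ^ _ = 0`.
  refine Summable.of_norm_bounded_eventually h2 ?_
  filter_upwards [(Set.finite_singleton (0 : ι → ℤ)).compl_mem_cofinite] with ω hω
  have hpos : 0 < ‖intVec ω‖ := by
    rw [norm_pos_iff]
    intro h0
    apply hω
    ext i
    simpa using congrFun h0 i
  have : (fun z : Submodule.span ℤ (Set.range (Pi.basisFun ℝ ι)) => ‖z‖⁻¹ ^ (Fintype.card ι + 1))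
      (b.equivFun.symm ω) = ‖intVec ω‖⁻¹ ^ (Fintype.card ι + 1) := by
    simp only [hcoe]
  refine le_of_le_of_eq ?_ this.symm
  rw [norm_pow, norm_inv, Real.norm_of_nonneg (by positivity)]
  gcongr
  linarith

/-- The translates of a Schwartz function by integer vectors are summable, uniformly on balls. -/
theorem exists_summable_bound (f : 𝓢(ι → ℝ, ℂ)) (R : ℝ) :
    ∃ u : (ι → ℤ) → ℝ, Summable u ∧
      ∀ ω, ∀ x ∈ Metric.ball (0 : ι → ℝ) R, ‖f (x + intVec ω)‖ ≤ u ω := by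
  set k := Fintype.card ι + 1
  obtain ⟨C, hC⟩ : ∃ C : ℝ, ∀ x, (1 + ‖x‖) ^ k * ‖f x‖ ≤ C := by
    refine ⟨2 ^ k * ((Finset.Iic (k, 0)).sup fun m => SchwartzMap.seminorm ℝ m.1 m.2) f,
      fun x => ?_⟩
    have := SchwartzMap.one_add_le_sup_seminorm_apply (𝕜 := ℝ) (m := (k, 0)) le_rfl le_rfl f x
    rwa [norm_iteratedFDeriv_zero] at this
  refine ⟨fun ω => C * (1 + R) ^ k * (1 + ‖intVec ω‖)⁻¹ ^ k,
    summable_one_add_norm_intVec.mul_left _, fun ω x hx => ?_⟩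
  have hx' : ‖x‖ < R := by simpa using hx
  have hR : 0 ≤ R := (norm_nonneg x).trans hx'.le
  have h1 : 1 + ‖intVec ω‖ ≤ (1 + R) * (1 + ‖x + intVec ω‖) := by
    have : ‖intVec ω‖ ≤ ‖x + intVec ω‖ + ‖x‖ := by
      simpa using norm_sub_le (x + intVec ω) x
    nlinarith [norm_nonneg (x + intVec ω)]
  beta_reduce
  rw [inv_pow, ← div_eq_mul_inv, le_div_iff₀ (by positivity)]
  calc ‖f (x + intVec ω)‖ * (1 + ‖intVec ω‖) ^ k
      ≤ ‖f (x + intVec ω)‖ * ((1 + R) * (1 + ‖x + intVec ω‖)) ^ k := by gcongr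
    _ = (1 + R) ^ k * ((1 + ‖x + intVec ω‖) ^ k * ‖f (x + intVec ω)‖) := by rw [mul_pow]; ring
    _ ≤ (1 + R) ^ k * C := by gcongr; exact hC _
    _ = C * (1 + R) ^ k := mul_comm _ _

theorem summable_schwartzMap_add_intVec (f : 𝓢(ι → ℝ, ℂ)) (x : ι → ℝ) :
    Summable fun ω => f (x + intVec ω) := by
  obtain ⟨u, hu, hf⟩ := exists_summable_bound f (‖x‖ + 1)
  exact Summable.of_norm_bounded hu fun ω => hf ω x (by simp)

theorem summable_schwartzMap_intVec (f : 𝓢(ι → ℝ, ℂ)) : Summable fun ω => f (intVec ω) := by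
  simpa using summable_schwartzMap_add_intVec f 0

theorem continuous_periodization (f : 𝓢(ι → ℝ, ℂ)) :
    Continuous fun x => ∑' ω, f (x + intVec ω) := by
  rw [continuous_iff_continuousAt]
  intro x
  obtain ⟨u, hu, hf⟩ := exists_summable_bound f (‖x‖ + 1)
  have hc : ContinuousOn (fun x => ∑' ω, f (x + intVec ω)) (Metric.ball 0 (‖x‖ + 1)) :=
    continuousOn_tsum (fun ω => (f.continuous.comp (continuous_add_const _)).continuousOn) hu hf
  exact hc.continuousAt (Metric.isOpen_ball.mem_nhds (by simp))

/-- The periodization of a Schwartz function descends to a continuous function on the torus. -/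
theorem exists_torus_periodization (f : 𝓢(ι → ℝ, ℂ)) :
    ∃ G : C(UnitAddTorus ι, ℂ), ∀ x : ι → ℝ, G (fun i => x i) = ∑' ω, f (x + intVec ω) := by
  set p : (ι → ℝ) → UnitAddTorus ι := fun x i => (x i : UnitAddCircle) with hp
  have hq : IsOpenQuotientMap p :=
    IsOpenQuotientMap.piMap fun _ => QuotientAddGroup.isOpenQuotientMap_mk
  set P : (ι → ℝ) → ℂ := fun x => ∑' ω, f (x + intVec ω) with hP
  have hper : ∀ x y, p x = p y → P x = P y := by
    intro x y hxy
    have h : ∀ i, ∃ n : ℤ, x i = y i + n := by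
      intro i
      have h0 : ((x i - y i : ℝ) : UnitAddCircle) = 0 := by
        rw [AddCircle.coe_sub, sub_eq_zero]
        exact congrFun hxy i
      obtain ⟨n, hn⟩ := (AddCircle.coe_eq_zero_iff 1).1 h0
      exact ⟨n, by simp at hn; linarith⟩
    choose n hn using h
    have hx : x = y + intVec n := by ext i; simp [hn]
    rw [hP, hx]
    beta_reduce
    rw [← (Equiv.addLeft n).tsum_eq (fun ω => f (y + intVec ω))]
    congr 1
    ext ω
    congr 1
    ext i
    simp [add_assoc]
  refine ⟨⟨fun t => P (Function.surjInv hq.surjective t), ?_⟩, fun x => ?_⟩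
  · rw [hq.isQuotientMap.continuous_iff]
    refine (continuous_periodization f).congr fun x => ?_
    exact hper _ _ (Function.surjInv_eq hq.surjective _).symm
  · exact hper _ _ (Function.surjInv_eq hq.surjective _)

/-- Unfolding: the integer translates of the half-open unit cube tile space. -/
theorem hasSum_setIntegral_unitCube {g : (ι → ℝ) → ℂ} (hg : Integrable g) :
    HasSum (fun ω : ι → ℤ => ∫ x in {x : ι → ℝ | ∀ i, x i ∈ Set.Ioc (0 : ℝ) (0 + 1)},
      g (x + intVec ω)) (∫ x, g x) := by
  set s : (ι → ℤ) → Set (ι → ℝ) :=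
    fun ω => {x | ∀ i, x i - ω i ∈ Set.Ioc (0 : ℝ) (0 + 1)} with hs
  have huniv : ⋃ ω, s ω = Set.univ := by
    refine Set.eq_univ_of_forall fun x => Set.mem_iUnion.2 ⟨fun i => ⌈x i⌉ - 1, fun i => ?_⟩
    have h1 := Int.le_ceil (x i)
    have h2 := Int.ceil_lt_add_one (x i)
    constructor <;> push_cast <;> linarith
  have hm : ∀ ω, MeasurableSet (s ω) := by
    intro ω
    simp only [hs, Set.ofPred_forall]
    exact MeasurableSet.iInter fun i => measurableSet_Ioc.preimage (by fun_prop)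
  have hd : Pairwise (Function.onFun Disjoint s) := by
    intro ω ω' hne
    refine Set.disjoint_left.2 fun x hx hx' => hne ?_
    ext i
    have h1 := hx i
    have h2 := hx' i
    simp only [Set.mem_Ioc] at h1 h2
    have h3 : (ω i : ℝ) < ω' i + 1 := by linarith
    have h4 : (ω' i : ℝ) < ω i + 1 := by linarith
    norm_cast at h3 h4
    omega
  have h := hasSum_integral_iUnion hm hd (hg.integrableOn (s := ⋃ ω, s ω))
  rw [huniv, setIntegral_univ] at h
  convert! h using 2 with ω
  refine Eq.trans ?_ ((measurePreserving_add_right volume (intVec ω)).setIntegral_preimage_emb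
    (measurableEmbedding_addRight (intVec ω)) g (s ω))
  congr 2
  ext x
  simp [hs]

theorem mFourier_neg_coe (n : ι → ℤ) (x : ι → ℝ) :
    UnitAddTorus.mFourier (-n) (fun i => (x i : UnitAddCircle)) =
      cexp (((-2 * Real.pi * ∑ i, x i * n i : ℝ) : ℂ) * I) := by
  simp only [UnitAddTorus.mFourier, ContinuousMap.coe_mk, fourier_coe_apply]
  rw [← Complex.exp_sum]
  congr 1
  push_cast
  rw [Finset.mul_sum, Finset.sum_mul]
  refine Finset.sum_congr rfl fun i _ => ?_
  simp
  ring

theorem mFourierCoeff_periodization (f : 𝓢(ι → ℝ, ℂ)) (G : C(UnitAddTorus ι, ℂ))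
    (hG : ∀ x : ι → ℝ, G (fun i => x i) = ∑' ω, f (x + intVec ω)) (n : ι → ℤ) :
    UnitAddTorus.mFourierCoeff G n =
      ∫ x : ι → ℝ, cexp (((-2 * Real.pi * ∑ i, x i * n i : ℝ) : ℂ) * I) * f x := by
  set e : (ι → ℝ) → ℂ := fun x => cexp (((-2 * Real.pi * ∑ i, x i * n i : ℝ) : ℂ) * I) with he
  have hen : ∀ x, ‖e x‖ = 1 := fun x => Complex.norm_exp_ofReal_mul_I _
  have hec : Continuous e := by fun_prop
  have hper : ∀ x ω, e (x + intVec ω) = e x := by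
    intro x ω
    rw [he]
    beta_reduce
    rw [← mFourier_neg_coe, ← mFourier_neg_coe]
    congr 1
    ext i
    simp
  have hint : Integrable fun x => e x * f x :=
    f.integrable.bdd_mul (c := 1) hec.aestronglyMeasurable
      (Eventually.of_forall fun x => (hen x).le)
  rw [UnitAddTorus.mFourierCoeff_eq_integral _ _ 0]
  have h1 := hasSum_setIntegral_unitCube hint
  rw [← h1.tsum_eq]
  obtain ⟨u, hu, hf⟩ := exists_summable_bound f 2
  set Q : Set (ι → ℝ) := {x : ι → ℝ | ∀ i, x i ∈ Set.Ioc (0 : ℝ) (0 + 1)} with hQ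
  have hQb : Q ⊆ Metric.ball 0 2 := by
    intro x hx
    rw [mem_ball_zero_iff, pi_norm_lt_iff two_pos]
    intro i
    have := hx i
    simp only [Set.mem_Ioc] at this
    rw [Real.norm_eq_abs, abs_lt]
    constructor <;> linarith
  have hQm : MeasurableSet Q := by
    simp only [hQ, Set.ofPred_forall]
    exact MeasurableSet.iInter fun i => measurableSet_Ioc.preimage (by fun_prop)
  have hQf : volume Q ≠ ⊤ :=
    (lt_of_le_of_lt (measure_mono hQb) Metric.isBounded_ball.measure_lt_top).ne
  rw [integral_tsum_of_summable_integral_norm]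
  · refine setIntegral_congr_fun hQm fun x hx => ?_
    simp only [hper]
    rw [tsum_mul_left, ← hG, mFourier_neg_coe]
    rfl
  · exact fun ω => (hint.comp_add_right (intVec ω)).integrableOn
  · refine Summable.of_norm_bounded (hu.mul_right (volume.real Q)) fun ω => ?_
    refine norm_setIntegral_le_of_norm_le_const hQf.lt_top fun x hx => ?_
    rw [norm_norm, norm_mul, hen, one_mul]
    exact hf ω x (hQb hx)

/-- Poisson summation, with the Fourier transform as an explicit integral: the Fourier series of the
periodization, evaluated at `0`. -/
theorem tsum_eq_tsum_integral (f : 𝓢(ι → ℝ, ℂ))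
    (hF : Summable fun n : ι → ℤ =>
      ∫ x : ι → ℝ, cexp (((-2 * Real.pi * ∑ i, x i * n i : ℝ) : ℂ) * I) * f x) :
    ∑' ω, f (intVec ω) = ∑' n : ι → ℤ,
      ∫ x : ι → ℝ, cexp (((-2 * Real.pi * ∑ i, x i * n i : ℝ) : ℂ) * I) * f x := by
  obtain ⟨G, hG⟩ := exists_torus_periodization f
  have hc := funext (mFourierCoeff_periodization f G hG)
  rw [← hc] at hF
  have h := UnitAddTorus.hasSum_mFourier_series_apply_of_summable hF
    (fun i => ((0 : ℝ) : UnitAddCircle))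
  have hG0 := hG 0
  simp only [zero_add, Pi.zero_apply] at hG0
  rw [hG0] at h
  rw [← h.tsum_eq]
  refine tsum_congr fun n => ?_
  rw [← mFourierCoeff_periodization f G hG]
  simp [UnitAddTorus.mFourier]

/-- A Schwartz function on Euclidean space as a Schwartz function on `ι → ℝ`, which carries the
sup norm and is the space on which periodization and the unit cube are described. -/
noncomputable def toPi (f : 𝓢(EuclideanSpace ℝ ι, ℂ)) : 𝓢(ι → ℝ, ℂ) :=
  SchwartzMap.compCLMOfContinuousLinearEquiv ℂ (EuclideanSpace.equiv ι ℝ).symm f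

theorem toPi_apply (f : 𝓢(EuclideanSpace ℝ ι, ℂ)) (x : ι → ℝ) : toPi f x = f (WithLp.toLp 2 x) :=
  rfl

theorem integral_toPi (f : 𝓢(EuclideanSpace ℝ ι, ℂ)) (n : ι → ℤ) :
    ∫ x : ι → ℝ, cexp (((-2 * Real.pi * ∑ i, x i * n i : ℝ) : ℂ) * I) * toPi f x =
      𝓕 f (WithLp.toLp 2 (intVec n)) := by
  rw [SchwartzMap.fourier_coe, Real.fourier_eq',
    ← (PiLp.volume_preserving_toLp ι).integral_comp
      (MeasurableEquiv.toLp 2 (ι → ℝ)).measurableEmbedding]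
  congr 1
  ext x
  rw [toPi_apply, smul_eq_mul]
  congr 4
  simp [PiLp.inner_apply, mul_comm]

theorem summable_schwartzMap_euclideanSpace (f : 𝓢(EuclideanSpace ℝ ι, ℂ)) :
    Summable fun ω : ι → ℤ => f (WithLp.toLp 2 (intVec ω)) :=
  summable_schwartzMap_intVec (toPi f)

/-- Poisson summation for Schwartz functions on `ℝ^ι` and the lattice `ℤ^ι`. -/
theorem tsum_eq_tsum_fourier (f : 𝓢(EuclideanSpace ℝ ι, ℂ)) :
    ∑' ω : ι → ℤ, f (WithLp.toLp 2 (intVec ω)) =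
      ∑' ω : ι → ℤ, 𝓕 f (WithLp.toLp 2 (intVec ω)) := by
  have h := tsum_eq_tsum_integral (toPi f)
  simp only [integral_toPi] at h
  exact h (summable_schwartzMap_euclideanSpace (𝓕 f))

end Poisson

/-! ### Euclidean coordinates on real matrices -/

section Coordinates

variable {m n : ℕ}

/-- The identification of Euclidean space of dimension `m n` with `m × n` matrices, under which the
inner product is `tr (ᵗx y)`. -/
noncomputable def reshape (m n : ℕ) :
    EuclideanSpace ℝ (Fin m × Fin n) ≃L[ℝ] Matrix (Fin m) (Fin n) ℝ :=
  LinearEquiv.toContinuousLinearEquiv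
    { toFun := fun v => Matrix.of fun i j => v (i, j)
      invFun := fun x => WithLp.toLp 2 fun p => x p.1 p.2
      map_add' := fun _ _ => rfl
      map_smul' := fun _ _ => rfl
      left_inv := fun _ => rfl
      right_inv := fun _ => rfl }

@[simp] theorem reshape_apply (v : EuclideanSpace ℝ (Fin m × Fin n)) (i : Fin m) (j : Fin n) :
    reshape m n v i j = v (i, j) := rfl

theorem measurePreserving_uncurry :
    MeasurePreserving (fun (x : Fin m → Fin n → ℝ) (p : Fin m × Fin n) => x p.1 p.2) := by
  refine ⟨by fun_prop, ?_⟩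
  refine (Measure.pi_eq fun s hs => ?_).symm
  rw [Measure.map_apply (by fun_prop) (MeasurableSet.univ_pi hs)]
  have : (fun (x : Fin m → Fin n → ℝ) (p : Fin m × Fin n) => x p.1 p.2) ⁻¹' Set.univ.pi s =
      Set.univ.pi fun i => Set.univ.pi fun j => s (i, j) := by
    ext x
    simp [Prod.forall]
  rw [this, volume_pi_pi, Fintype.prod_prod_type]
  simp only [volume_pi_pi]

theorem integral_of_eq_integral_reshape (h : Matrix (Fin m) (Fin n) ℝ → ℂ) :
    ∫ y : Fin m → Fin n → ℝ, h (Matrix.of y) = ∫ v, h (reshape m n v) := by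
  have hmp := (PiLp.volume_preserving_toLp (Fin m × Fin n)).comp
    (measurePreserving_uncurry (m := m) (n := n))
  have he : MeasurableEmbedding (WithLp.toLp 2 ∘
      fun (x : Fin m → Fin n → ℝ) (p : Fin m × Fin n) => x p.1 p.2) := by
    refine (MeasurableEquiv.toLp 2 (Fin m × Fin n → ℝ)).measurableEmbedding.comp ?_
    exact (MeasurableEquiv.curry (Fin m) (Fin n) ℝ).symm.measurableEmbedding
  rw [← hmp.integral_comp he]
  rfl

theorem form_add_left (M : Matrix (Fin m) (Fin m) ℝ) (x y z : Matrix (Fin m) (Fin n) ℝ) :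
    form M (x + y) z = form M x z + form M y z := by
  simp [form, Matrix.add_mul]

theorem form_add_right (M : Matrix (Fin m) (Fin m) ℝ) (x y z : Matrix (Fin m) (Fin n) ℝ) :
    form M x (y + z) = form M x y + form M x z := by
  simp [form, Matrix.mul_add]

theorem form_neg_left (M : Matrix (Fin m) (Fin m) ℝ) (x y : Matrix (Fin m) (Fin n) ℝ) :
    form M (-x) y = -form M x y := by
  simp [form]

theorem form_comm {M : Matrix (Fin m) (Fin m) ℝ} (hM : M.IsSymm)
    (x y : Matrix (Fin m) (Fin n) ℝ) : form M x y = form M y x := by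
  rw [form, form, ← Matrix.trace_transpose]
  simp [Matrix.transpose_mul, hM.eq, Matrix.mul_assoc]

theorem trace_mul_mul_transpose (M : Matrix (Fin m) (Fin m) ℝ)
    (x y : Matrix (Fin m) (Fin n) ℝ) : (M * (x * y.transpose)).trace = form M y x := by
  rw [form, ← Matrix.mul_assoc, Matrix.trace_mul_comm, Matrix.mul_assoc]

theorem trace_transpose_mul_eq_inner (v w : EuclideanSpace ℝ (Fin m × Fin n)) :
    ((reshape m n v).transpose * reshape m n w).trace = ⟪v, w⟫ := by
  simp only [Matrix.trace, Matrix.diag, Matrix.mul_apply, Matrix.transpose_apply, reshape_apply,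
    PiLp.inner_apply, Fintype.sum_prod_type]
  rw [Finset.sum_comm]
  simp [mul_comm]

/-- Left multiplication by an `m × m` matrix on `m × n` matrices, in Euclidean coordinates. -/
noncomputable def leftMul (n : ℕ) (A : Matrix (Fin m) (Fin m) ℝ) :
    EuclideanSpace ℝ (Fin m × Fin n) →ₗ[ℝ] EuclideanSpace ℝ (Fin m × Fin n) where
  toFun v := (reshape m n).symm (A * reshape m n v)
  map_add' v w := by simp [Matrix.mul_add]
  map_smul' c v := by simp

theorem reshape_leftMul (A : Matrix (Fin m) (Fin m) ℝ) (v : EuclideanSpace ℝ (Fin m × Fin n)) :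
    reshape m n (leftMul n A v) = A * reshape m n v :=
  (reshape m n).apply_symm_apply _

/-- Left multiplication acts on the `n` columns separately. -/
theorem det_leftMul (A : Matrix (Fin m) (Fin m) ℝ) : LinearMap.det (leftMul n A) = A.det ^ n := by
  let e : EuclideanSpace ℝ (Fin m × Fin n) ≃ₗ[ℝ] (Fin n → Fin m → ℝ) :=
    { toFun := fun v j i => v (i, j)
      invFun := fun x => WithLp.toLp 2 fun p => x p.2 p.1
      map_add' := fun _ _ => rfl
      map_smul' := fun _ _ => rfl
      left_inv := fun _ => rfl
      right_inv := fun _ => rfl }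
  have h : e.toLinearMap ∘ₗ leftMul n A ∘ₗ e.symm.toLinearMap =
      LinearMap.pi fun j => (Matrix.toLin' A).comp (LinearMap.proj j) := by
    ext
    rfl
  rw [← LinearMap.det_conj (leftMul n A) e, h, LinearMap.det_pi]
  simp

open scoped MatrixOrder in
theorem exists_transpose_mul_self {M : Matrix (Fin m) (Fin m) ℝ} (hM : M.PosDef) :
    ∃ B : Matrix (Fin m) (Fin m) ℝ, M = B.transpose * B := by
  have h0 : 0 ≤ M := hM.posSemidef.nonneg
  refine ⟨CFC.sqrt M, ?_⟩
  have h1 : (CFC.sqrt M).IsHermitian := 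
    (Matrix.nonneg_iff_posSemidef.1 (CFC.sqrt_nonneg M)).isHermitian
  rw [← Matrix.conjTranspose_eq_transpose_of_trivial, h1.eq, CFC.sqrt_mul_sqrt_self M h0]

/-- Coordinates that turn the form of `M` into the Euclidean inner product: with `M = ᵗB B`, they
are `x ↦ B x`. The Jacobian `|det B| ^ n` is `(det M) ^ (n / 2)`, the normalization of `weilR`. -/
theorem exists_isometric_coordinates {M : Matrix (Fin m) (Fin m) ℝ} (hM : M.PosDef) :
    ∃ T : EuclideanSpace ℝ (Fin m × Fin n) ≃L[ℝ] Matrix (Fin m) (Fin n) ℝ,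
      (∀ v w, form M (T v) (T w) = ⟪v, w⟫) ∧
      ∀ h : Matrix (Fin m) (Fin n) ℝ → ℂ,
        ((M.det ^ ((n : ℝ) / 2) : ℝ) : ℂ) * ∫ y : Fin m → Fin n → ℝ, h (Matrix.of y) =
          ∫ v, h (T v) := by
  obtain ⟨B, hBM⟩ := exists_transpose_mul_self hM
  have hMB : M.det = B.det ^ 2 := by rw [hBM, Matrix.det_mul, Matrix.det_transpose, sq]
  have hB : B.det ≠ 0 := by
    intro h
    have := hM.det_pos
    simp [hMB, h] at this
  have hu : IsUnit B.det := isUnit_iff_ne_zero.2 hB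
  have hA : LinearMap.det (leftMul n B⁻¹) ≠ 0 := by
    rw [det_leftMul, Matrix.det_nonsing_inv, Ring.inverse_eq_inv']
    exact pow_ne_zero _ (inv_ne_zero hB)
  set e := (LinearEquiv.ofIsUnitDet (f := leftMul n B⁻¹)
    (v := (EuclideanSpace.basisFun _ ℝ).toBasis)
    (v' := (EuclideanSpace.basisFun _ ℝ).toBasis)
    (by rw [LinearMap.det_toMatrix]; exact isUnit_iff_ne_zero.2 hA)).toContinuousLinearEquiv with he
  have hev : ∀ v, e v = leftMul n B⁻¹ v := fun v => rfl
  have hBT : ∀ v, B * reshape m n (e v) = reshape m n v := by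
    intro v
    rw [hev, reshape_leftMul, ← Matrix.mul_assoc, Matrix.mul_nonsing_inv _ hu, Matrix.one_mul]
  refine ⟨e.trans (reshape m n), fun v w => ?_, fun h => ?_⟩
  · rw [← trace_transpose_mul_eq_inner, ← hBT v, ← hBT w, form, hBM]
    simp [Matrix.transpose_mul, Matrix.mul_assoc]
  · have hmap := Measure.map_linearMap_addHaar_eq_smul_addHaar
      (volume : Measure (EuclideanSpace ℝ (Fin m × Fin n))) hA
    have hemb : MeasurableEmbedding (leftMul n B⁻¹) := e.toHomeomorph.measurableEmbedding
    have h1 := hemb.integral_map (μ := volume) (fun v => h (reshape m n v))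
    rw [hmap, integral_smul_measure] at h1
    rw [integral_of_eq_integral_reshape]
    refine Eq.trans ?_ h1
    rw [ENNReal.toReal_ofReal (abs_nonneg _), real_smul]
    congr 2
    rw [det_leftMul, Matrix.det_nonsing_inv, Ring.inverse_eq_inv', inv_pow, inv_inv, abs_pow, hMB,
      ← sq_abs, ← Real.rpow_natCast (|B.det|) 2, ← Real.rpow_mul (abs_nonneg _),
      ← Real.rpow_natCast]
    congr 1
    push_cast
    ring

end Coordinates

/-! ### Matrices in `SL(2, ℝ)` -/

section SpecialLinear

theorem entries_det_eq_one (g : SL(2, ℝ)) : g 0 0 * g 1 1 - g 0 1 * g 1 0 = 1 := by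
  have := g.det_coe
  rwa [Matrix.det_fin_two] at this

theorem coe_matS_mul (g : SL(2, ℝ)) :
    ((matS * g : SL(2, ℝ)) : Matrix (Fin 2) (Fin 2) ℝ) =
      !![-g 1 0, -g 1 1; g 0 0, g 0 1] := by
  rw [Matrix.SpecialLinearGroup.coe_mul, Matrix.eta_fin_two (g : Matrix (Fin 2) (Fin 2) ℝ)]
  simp only [matS, Matrix.mul_fin_two]
  simp

theorem iwasawa_coe (τ : ℍ) (φ : ℝ) :
    (iwasawa τ φ : Matrix (Fin 2) (Fin 2) ℝ) =
      !![√τ.im * Real.cos φ + τ.re * (√τ.im)⁻¹ * Real.sin φ,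
        -(√τ.im * Real.sin φ) + τ.re * (√τ.im)⁻¹ * Real.cos φ;
        (√τ.im)⁻¹ * Real.sin φ, (√τ.im)⁻¹ * Real.cos φ] := by
  simp [iwasawa]

/-- In Iwasawa coordinates, `S` acts by `(τ, φ) ↦ (-1/τ, φ + arg τ)`. -/
theorem matS_mul_iwasawa (τ : ℍ) (φ : ℝ) :
    matS * iwasawa τ φ = iwasawa (negInv τ) (φ + Complex.arg (τ : ℂ)) := by
  apply Subtype.ext
  rw [coe_matS_mul, iwasawa_coe, iwasawa_coe]
  set r := ‖(τ : ℂ)‖ with hr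
  set θ := Complex.arg (τ : ℂ) with hθ
  have hτ : (τ : ℂ) ≠ 0 := τ.ne_zero
  have hr0 : 0 < r := norm_pos_iff.2 hτ
  have hv := τ.im_pos
  have hu : τ.re = r * Real.cos θ := (Complex.norm_mul_cos_arg (τ : ℂ)).symm
  have hv' : τ.im = r * Real.sin θ := (Complex.norm_mul_sin_arg (τ : ℂ)).symm
  have hnsq : Complex.normSq (τ : ℂ) = r ^ 2 := Complex.normSq_eq_norm_sq _
  have hre : (negInv τ).re = -τ.re / r ^ 2 := by
    change (-1 / (τ : ℂ)).re = _
    rw [neg_div, one_div, neg_re, inv_re, hnsq, neg_div]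
    rfl
  have him : (negInv τ).im = τ.im / r ^ 2 := by
    change (-1 / (τ : ℂ)).im = _
    rw [neg_div, one_div, neg_im, inv_im, hnsq, neg_div, neg_neg]
    rfl
  have hs : √(negInv τ).im = √τ.im / r := by
    rw [him, Real.sqrt_div hv.le, Real.sqrt_sq hr0.le]
  have hq : 0 < √τ.im := Real.sqrt_pos.2 hv
  have hq2 : √τ.im ^ 2 = r * Real.sin θ := by rw [Real.sq_sqrt hv.le, hv']
  rw [hre, hs, Real.cos_add, Real.sin_add, hu]
  have hcs := Real.sin_sq_add_cos_sq θ
  generalize √τ.im = q at hq hq2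
  ext i j
  fin_cases i <;> fin_cases j <;> simp <;> field_simp <;> rw [hq2]
  · linear_combination (r * Real.sin φ) * hcs
  · linear_combination (r * Real.cos φ) * hcs
  · ring
  · ring

theorem sign_mul_of_pos {a : ℝ} (ha : 0 < a) (x : ℝ) : Real.sign (a * x) = Real.sign x := by
  rcases lt_trichotomy x 0 with h | h | h
  · rw [Real.sign_of_neg h, Real.sign_of_neg (mul_neg_of_pos_of_neg ha h)]
  · rw [h, mul_zero]
  · rw [Real.sign_of_pos h, Real.sign_of_pos (mul_pos ha h)]

/-- The lower left entry of `(τ, φ)` is a positive multiple of `sin φ`. -/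
theorem sign_lowerLeft_matS_iwasawa (τ : ℍ) (φ : ℝ) :
    Real.sign (matS 1 0 * (iwasawa τ φ) 1 0 * (matS * iwasawa τ φ) 1 0) =
      Real.sign (Real.sin φ * Real.sin (φ + Complex.arg (τ : ℂ))) := by
  have h1 : matS 1 0 = 1 := rfl
  have h2 (σ : ℍ) (ψ : ℝ) : (iwasawa σ ψ) 1 0 = (√σ.im)⁻¹ * Real.sin ψ :=
    congrFun (congrFun (iwasawa_coe σ ψ) 1) 0
  have h3 (σ : ℍ) : 0 < (√σ.im)⁻¹ := inv_pos.2 (Real.sqrt_pos.2 σ.im_pos)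
  rw [matS_mul_iwasawa, h1, h2, h2, one_mul, mul_mul_mul_comm,
    sign_mul_of_pos (mul_pos (h3 _) (h3 _))]

end SpecialLinear

/-! ### The projective representation on functions of a matrix -/

section Matrices

variable {m n : ℕ}

theorem cocycle_matS (m n : ℕ) (g : SL(2, ℝ)) :
    cocycle m n matS g =
      cexp (-(I * Real.pi * (m * n : ℕ) * (Real.sign (g 1 0 * g 0 0) : ℝ)) / 4) := by
  have h1 : (matS * g) 1 0 = g 0 0 := congrFun (congrFun (coe_matS_mul g) 1) 0
  have h2 : matS 1 0 = 1 := rfl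
  rw [cocycle, h1, h2, one_mul]
  push_cast
  congr 2
  ring

/-- In isometric coordinates, `R_M(g)` is the operator `R(g)` of Euclidean space; the hypothesis on
integrals cancels the determinant in the definition of `weilR`. -/
theorem weilR_apply_isometric {M : Matrix (Fin m) (Fin m) ℝ}
    {T : EuclideanSpace ℝ (Fin m × Fin n) ≃L[ℝ] Matrix (Fin m) (Fin n) ℝ}
    (hT : ∀ v w, form M (T v) (T w) = ⟪v, w⟫)
    (hint : ∀ h : Matrix (Fin m) (Fin n) ℝ → ℂ,
        ((M.det ^ ((n : ℝ) / 2) : ℝ) : ℂ) * ∫ y : Fin m → Fin n → ℝ, h (Matrix.of y) =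
          ∫ v, h (T v))
    (g : SL(2, ℝ)) (F : Matrix (Fin m) (Fin n) ℝ → ℂ) (v : EuclideanSpace ℝ (Fin m × Fin n)) :
    weilR M g F (T v) = weilStd (g 0 0) (g 0 1) (g 1 0) (g 1 1) (F ∘ T) v := by
  have hN : ((Module.finrank ℝ (EuclideanSpace ℝ (Fin m × Fin n)) : ℕ) : ℝ) = m * n := by simp
  rw [weilR, weilStd, hN]
  split_ifs with hc
  · rw [hT, real_inner_self_eq_norm_sq, Function.comp_apply, map_smul, chirp]
  · rw [mul_comm (M.det ^ _), ofReal_mul, mul_assoc]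
    congr 1
    have := hint (fun y => cexp (Real.pi * I *
          (((g 0 0 * form M (T v) (T v) + g 1 1 * form M y y
              - 2 * form M (T v) y) / g 1 0 : ℝ) : ℂ)) * F y)
    refine this.trans ?_
    simp only [hT, real_inner_self_eq_norm_sq, Function.comp_apply]

theorem exists_schwartzMap_eq_weilR {M : Matrix (Fin m) (Fin m) ℝ} (hM : M.PosDef)
    (g : SL(2, ℝ)) (F : 𝓢(Matrix (Fin m) (Fin n) ℝ, ℂ)) :
    ∃ G : 𝓢(Matrix (Fin m) (Fin n) ℝ, ℂ), ⇑G = weilR M g F := by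
  obtain ⟨T, hT, hint⟩ := exists_isometric_coordinates (n := n) hM
  obtain ⟨G, hG⟩ := exists_schwartzMap_eq_weilStd (entries_det_eq_one g)
    (SchwartzMap.compCLMOfContinuousLinearEquiv ℂ T F)
  refine ⟨SchwartzMap.compCLMOfContinuousLinearEquiv ℂ T.symm G, ?_⟩
  ext x
  obtain ⟨v, rfl⟩ := T.surjective x
  rw [weilR_apply_isometric hT hint]
  change G (T.symm (T v)) = _
  rw [T.symm_apply_apply, hG]
  rfl

theorem weilR_matS_mul {M : Matrix (Fin m) (Fin m) ℝ} (hM : M.PosDef)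
    (g : SL(2, ℝ)) (F : 𝓢(Matrix (Fin m) (Fin n) ℝ, ℂ)) (x : Matrix (Fin m) (Fin n) ℝ) :
    weilR M (matS * g) F x = cocycle m n matS g * weilR M matS (weilR M g F) x := by
  obtain ⟨T, hT, hint⟩ := exists_isometric_coordinates (n := n) hM
  obtain ⟨v, rfl⟩ := T.surjective x
  rw [weilR_apply_isometric hT hint, weilR_apply_isometric hT hint, coe_matS_mul]
  set K := SchwartzMap.compCLMOfContinuousLinearEquiv ℂ T F
  have hK : F ∘ T = K := rfl
  have h := weilStd_eq_fourier_weilStd (entries_det_eq_one g) K v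
  have hcomp : weilR M g F ∘ T = weilStd (g 0 0) (g 0 1) (g 1 0) (g 1 1) (F ∘ T) :=
    funext fun w => weilR_apply_isometric hT hint g F w
  have hS : weilStd (matS 0 0) (matS 0 1) (matS 1 0) (matS 1 1) (weilR M g F ∘ T) =
      𝓕 (weilR M g F ∘ T) := weilStd_zero_neg_one_one_zero _
  rw [hS, hcomp, cocycle_matS, hK]
  simpa using h

theorem weilR_matS (M : Matrix (Fin m) (Fin m) ℝ) (H : Matrix (Fin m) (Fin n) ℝ → ℂ)
    (x : Matrix (Fin m) (Fin n) ℝ) :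
    weilR M matS H x = ((M.det ^ ((n : ℝ) / 2) : ℝ) : ℂ) * ∫ y : Fin m → Fin n → ℝ,
      cexp (Real.pi * I * ((-2 * form M x (Matrix.of y) : ℝ) : ℂ)) * H (Matrix.of y) := by
  have h10 : matS 1 0 = 1 := rfl
  have h00 : matS 0 0 = 0 := rfl
  have h11 : matS 1 1 = 0 := rfl
  rw [weilR, h10, h00, h11, if_neg one_ne_zero]
  simp

/-- `R_M(S)` intertwines the Schrödinger operators: `R_M(S) W(λ, μ; κ) = W(-μ, λ; κ) R_M(S)`. -/
theorem weilR_matS_schrodinger {M : Matrix (Fin m) (Fin m) ℝ} (hM : M.IsSymm)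
    (lam mu : Matrix (Fin m) (Fin n) ℝ) (kap : Matrix (Fin m) (Fin m) ℝ)
    (G : Matrix (Fin m) (Fin n) ℝ → ℂ) (x : Matrix (Fin m) (Fin n) ℝ) :
    weilR M matS (schrodinger M lam mu kap G) x =
      schrodinger M (-mu) lam kap (weilR M matS G) x := by
  rw [schrodinger, weilR_matS, weilR_matS, mul_left_comm]
  congr 1
  rw [← integral_const_mul]
  -- After the translation `y ↦ y + λ` the two integrands agree.
  let lam' : Fin m → Fin n → ℝ := lam
  have h := integral_add_right_eq_self (μ := (volume : Measure (Fin m → Fin n → ℝ)))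
    (fun y => cexp (Real.pi * I *
      (((M * (kap + lam * (-mu).transpose + (2 : ℝ) • (x * lam.transpose))).trace : ℝ) : ℂ)) *
      (cexp (Real.pi * I * ((-2 * form M (x + -mu) (Matrix.of y) : ℝ) : ℂ)) * G (Matrix.of y)))
    lam'
  rw [← h]
  refine integral_congr_ae (Eventually.of_forall fun y => ?_)
  have hy : Matrix.of (y + lam') = Matrix.of y + lam := rfl
  beta_reduce
  rw [hy, schrodinger, ← mul_assoc, ← mul_assoc, ← Complex.exp_add, ← Complex.exp_add, ← mul_add,
    ← mul_add, ← ofReal_add, ← ofReal_add]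
  congr 4
  simp only [Matrix.mul_add, Matrix.trace_add, Matrix.mul_smul, Matrix.trace_smul,
    trace_mul_mul_transpose, form_add_left, form_add_right, form_neg_left, smul_eq_mul]
  rw [form_comm hM lam x, form_comm hM lam mu]
  ring

theorem exists_schwartzMap_eq_schrodinger (M : Matrix (Fin m) (Fin m) ℝ)
    (lam mu : Matrix (Fin m) (Fin n) ℝ) (kap : Matrix (Fin m) (Fin m) ℝ)
    (G : 𝓢(Matrix (Fin m) (Fin n) ℝ, ℂ)) :
    ∃ H : 𝓢(Matrix (Fin m) (Fin n) ℝ, ℂ), ⇑H = schrodinger M lam mu kap G := by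
  let ℓ : Matrix (Fin m) (Fin n) ℝ →ₗ[ℝ] ℝ :=
    { toFun := fun x => form M mu x
      map_add' := form_add_right M mu
      map_smul' := fun c x => by simp [form] }
  set c : ℝ := Real.pi * (M * (kap + mu * lam.transpose)).trace
  have hg : (fun x => c + 2 * Real.pi * ℓ.toContinuousLinearMap x).HasTemperateGrowth :=
    (Function.HasTemperateGrowth.const c).add
      ((Function.HasTemperateGrowth.const (2 * Real.pi)).mul
        ℓ.toContinuousLinearMap.hasTemperateGrowth)
  have hg2 := hasTemperateGrowth_cexp_ofReal_mul_I.comp hg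
  refine ⟨SchwartzMap.smulLeftCLM ℂ
    ((fun s : ℝ => cexp (s * I)) ∘ fun x => c + 2 * Real.pi * ℓ.toContinuousLinearMap x)
    (SchwartzMap.compSubConstCLM ℂ (-lam) G), ?_⟩
  · ext x
    rw [SchwartzMap.smulLeftCLM_apply_apply hg2, schrodinger, SchwartzMap.compSubConstCLM_apply,
      sub_neg_eq_add, smul_eq_mul]
    congr 1
    simp only [Function.comp_apply]
    congr 1
    have : ℓ.toContinuousLinearMap x = form M mu x := rfl
    rw [this, Matrix.mul_add, Matrix.trace_add, Matrix.mul_smul, Matrix.trace_smul,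
      trace_mul_mul_transpose, mul_right_comm (Real.pi : ℂ), ← ofReal_mul]
    congr 2
    simp only [c, smul_eq_mul]
    ring

end Matrices

/-! ### The lattice of integral matrices -/

section Lattice

variable {m n : ℕ}

/-- Integral `m × n` matrices as integer vectors indexed by the entries. -/
def intMatrixEquiv (m n : ℕ) : Matrix (Fin m) (Fin n) ℤ ≃ (Fin m × Fin n → ℤ) where
  toFun ω p := ω p.1 p.2
  invFun k := Matrix.of fun i j => k (i, j)
  left_inv _ := rfl
  right_inv _ := rfl

theorem reshape_symm_map_intCast (ω : Matrix (Fin m) (Fin n) ℤ) :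
    (reshape m n).symm (ω.map (Int.cast : ℤ → ℝ)) =
      WithLp.toLp 2 (intVec (intMatrixEquiv m n ω)) := rfl

theorem summable_schwartzMap_intMatrix (H : 𝓢(Matrix (Fin m) (Fin n) ℝ, ℂ)) :
    Summable fun ω : Matrix (Fin m) (Fin n) ℤ => H (ω.map (Int.cast : ℤ → ℝ)) := by
  have h := summable_schwartzMap_euclideanSpace
    (SchwartzMap.compCLMOfContinuousLinearEquiv ℂ (reshape m n) H)
  exact (intMatrixEquiv m n).summable_iff.2 h

/-- A matrix that maps the integral `m × n` matrices onto themselves is unimodular: the first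
columns of preimages form a right inverse. -/
theorem isUnit_det_of_range_mul_eq_univ (hn : 0 < n) {M₀ : Matrix (Fin m) (Fin m) ℤ}
    (h : Set.range (fun ω : Matrix (Fin m) (Fin n) ℤ => M₀ * ω) = Set.univ) :
    IsUnit M₀.det := by
  have hex : ∀ i : Fin m, ∃ w : Fin m → ℤ, M₀.mulVec w = Pi.single i 1 := by
    intro i
    obtain ⟨ω, hω⟩ := Set.range_eq_univ.1 h
      (Matrix.of fun k _ => (Pi.single i 1 : Fin m → ℤ) k)
    refine ⟨fun k => ω k ⟨0, hn⟩, ?_⟩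
    ext k
    exact congrFun (congrFun hω k) ⟨0, hn⟩
  choose w hw using hex
  have hmul : M₀ * (Matrix.of w).transpose = 1 := by
    ext k i
    rw [Matrix.one_apply]
    refine (congrFun (hw i) k).trans ?_
    rw [Pi.single_apply]
  exact IsUnit.of_mul_eq_one _ (by rw [← Matrix.det_mul, hmul, Matrix.det_one])

theorem det_eq_one_of_isUnit {M₀ : Matrix (Fin m) (Fin m) ℤ} {M : Matrix (Fin m) (Fin m) ℝ}
    (hM₀ : M = M₀.map (Int.cast : ℤ → ℝ)) (hM : M.PosDef) (hu : IsUnit M₀.det) : M.det = 1 := by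
  have hd : M.det = (M₀.det : ℝ) := by
    rw [hM₀]
    exact ((Int.castRingHom ℝ).map_det M₀).symm
  have hpos := hM.det_pos
  rcases Int.isUnit_iff.1 hu with h | h
  · rw [hd, h]; simp
  · rw [hd, h] at hpos; norm_num at hpos

theorem bijective_mul_left {M₀ : Matrix (Fin m) (Fin m) ℤ} (hu : IsUnit M₀.det) :
    Function.Bijective (fun ω : Matrix (Fin m) (Fin n) ℤ => M₀ * ω) := by
  refine Function.bijective_iff_has_inverse.2 ⟨fun ω => M₀⁻¹ * ω, fun ω => ?_, fun ω => ?_⟩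
  · simp [← Matrix.mul_assoc, Matrix.nonsing_inv_mul _ hu]
  · simp [← Matrix.mul_assoc, Matrix.mul_nonsing_inv _ hu]

/-- Poisson summation for `R_M(S)`: its value at `ω` is the Fourier transform at `M ω`, and `M`
permutes the lattice. -/
theorem tsum_weilR_matS {M₀ : Matrix (Fin m) (Fin m) ℤ} {M : Matrix (Fin m) (Fin m) ℝ}
    (hM₀ : M = M₀.map (Int.cast : ℤ → ℝ)) (hM : M.PosDef) (hu : IsUnit M₀.det)
    (H : 𝓢(Matrix (Fin m) (Fin n) ℝ, ℂ)) :
    ∑' ω : Matrix (Fin m) (Fin n) ℤ, weilR M matS H (ω.map (Int.cast : ℤ → ℝ)) =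
      ∑' ω : Matrix (Fin m) (Fin n) ℤ, H (ω.map (Int.cast : ℤ → ℝ)) := by
  have hsymm : M.transpose = M := by
    rw [← Matrix.conjTranspose_eq_transpose_of_trivial, hM.isHermitian.eq]
  set K := SchwartzMap.compCLMOfContinuousLinearEquiv ℂ (reshape m n) H with hK
  have hR : ∀ ω : Matrix (Fin m) (Fin n) ℤ, weilR M matS H (ω.map (Int.cast : ℤ → ℝ)) =
      𝓕 K (WithLp.toLp 2 (intVec (intMatrixEquiv m n (M₀ * ω)))) := by
    intro ω
    rw [weilR_matS, det_eq_one_of_isUnit hM₀ hM hu, Real.one_rpow, ofReal_one, one_mul,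
      integral_of_eq_integral_reshape (fun y => cexp (Real.pi * I *
        ((-2 * form M (ω.map (Int.cast : ℤ → ℝ)) y : ℝ) : ℂ)) * H y),
      SchwartzMap.fourier_coe, Real.fourier_eq']
    congr 1
    ext v
    rw [smul_eq_mul]
    congr 1
    have hmap : (M₀ * ω).map (Int.cast : ℤ → ℝ) = M * ω.map (Int.cast : ℤ → ℝ) := by
      rw [hM₀]
      exact Matrix.map_mul (f := Int.castRingHom ℝ)
    rw [← reshape_symm_map_intCast, real_inner_comm, ← trace_transpose_mul_eq_inner,
      (reshape m n).apply_symm_apply, hmap, Matrix.transpose_mul, hsymm]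
    congr 1
    simp only [form]
    push_cast
    ring
  have hP := tsum_eq_tsum_fourier K
  have h1 := (intMatrixEquiv m n).tsum_eq (fun k => K (WithLp.toLp 2 (intVec k)))
  have h2 := (intMatrixEquiv m n).tsum_eq (fun k => 𝓕 K (WithLp.toLp 2 (intVec k)))
  have h3 := (Equiv.ofBijective _ (bijective_mul_left (n := n) hu)).tsum_eq
    (fun ω => 𝓕 K (WithLp.toLp 2 (intVec (intMatrixEquiv m n ω))))
  simp only [hR]
  refine h3.trans (h2.trans (hP.symm.trans h1.symm))

end Lattice

/-! ### The transformation formula -/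

theorem summable_thetaTerm {m n : ℕ} {M : Matrix (Fin m) (Fin m) ℝ} (hM : M.PosDef)
    (f : 𝓢(Matrix (Fin m) (Fin n) ℝ, ℂ)) (τ : ℍ) (φ : ℝ)
    (lam mu : Matrix (Fin m) (Fin n) ℝ) (kap : Matrix (Fin m) (Fin m) ℝ) :
    Summable (thetaTerm M f τ φ lam mu kap) := by
  obtain ⟨G, hG⟩ := exists_schwartzMap_eq_weilR hM (iwasawa τ φ) f
  obtain ⟨H, hH⟩ := exists_schwartzMap_eq_schrodinger M lam mu kap G
  refine (summable_schwartzMap_intMatrix H).congr fun ω => ?_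
  rw [thetaTerm, hH, hG]

end ThetaSum

open ThetaSum in
theorem theorem3p1 (m n : ℕ) (hm : 0 < m) (hn : 0 < n)
    (M₀ : Matrix (Fin m) (Fin m) ℤ) (M : Matrix (Fin m) (Fin m) ℝ)
    (hM₀ : M = M₀.map (Int.cast : ℤ → ℝ)) (hM : M.PosDef)
    (hlat : Set.range (fun ω : Matrix (Fin m) (Fin n) ℤ => M₀ * ω) = Set.univ)
    (f : 𝓢(Matrix (Fin m) (Fin n) ℝ, ℂ)) (τ : ℍ) (φ : ℝ)
    (lam mu : Matrix (Fin m) (Fin n) ℝ) (kap : Matrix (Fin m) (Fin m) ℝ)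
    (hkap : (kap + mu * lam.transpose).IsSymm) :
    -- both theta series converge absolutely
    Summable (ThetaSum.thetaTerm M f τ φ lam mu kap) ∧
    Summable (ThetaSum.thetaTerm M f (ThetaSum.negInv τ) (φ + Complex.arg (τ : ℂ)) (-mu) lam kap) ∧
    -- the transformation formula
    ThetaSum.theta M f (ThetaSum.negInv τ) (φ + Complex.arg (τ : ℂ)) (-mu) lam kap =
      ((M.det ^ (-((n : ℝ) / 2)) : ℝ) : ℂ) *
        ThetaSum.cocycle m n ThetaSum.matS (ThetaSum.iwasawa τ φ) *
        ThetaSum.theta M f τ φ lam mu kap ∧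
    -- the value of the cocycle
    ThetaSum.cocycle m n ThetaSum.matS (ThetaSum.iwasawa τ φ) =
      Complex.exp (-(Complex.I * (Real.pi : ℂ) * (m : ℂ) * (n : ℂ) *
        ((Real.sign (Real.sin φ * Real.sin (φ + Complex.arg (τ : ℂ))) : ℝ) : ℂ)) / 4) ∧
    -- it is the cocycle of the projective representation
    ∀ x : Matrix (Fin m) (Fin n) ℝ,
      ThetaSum.weilR M (ThetaSum.matS * ThetaSum.iwasawa τ φ) f x =
        ThetaSum.cocycle m n ThetaSum.matS (ThetaSum.iwasawa τ φ) *
          ThetaSum.weilR M ThetaSum.matS (ThetaSum.weilR M (ThetaSum.iwasawa τ φ) f) x := by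
  have hu := isUnit_det_of_range_mul_eq_univ hn hlat
  have hsymm : M.IsSymm := by
    rw [Matrix.IsSymm, ← Matrix.conjTranspose_eq_transpose_of_trivial, hM.isHermitian.eq]
  obtain ⟨G, hG⟩ := exists_schwartzMap_eq_weilR hM (iwasawa τ φ) f
  obtain ⟨H, hH⟩ := exists_schwartzMap_eq_schrodinger M lam mu kap G
  refine ⟨summable_thetaTerm hM f τ φ lam mu kap, summable_thetaTerm hM f _ _ _ _ _, ?_, ?_,
    weilR_matS_mul hM _ f⟩
  · have hterm : ∀ ω : Matrix (Fin m) (Fin n) ℤ,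
        thetaTerm M f (negInv τ) (φ + Complex.arg (τ : ℂ)) (-mu) lam kap ω =
          cocycle m n matS (iwasawa τ φ) * weilR M matS H (ω.map (Int.cast : ℤ → ℝ)) := by
      intro ω
      rw [hH, weilR_matS_schrodinger hsymm, thetaTerm, ← matS_mul_iwasawa, schrodinger,
        schrodinger, weilR_matS_mul hM, hG, mul_left_comm]
    have hterm' : ∀ ω : Matrix (Fin m) (Fin n) ℤ,
        thetaTerm M f τ φ lam mu kap ω = H (ω.map (Int.cast : ℤ → ℝ)) := by
      intro ω
      rw [thetaTerm, hH, hG]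
    rw [theta, theta, tsum_congr hterm, tsum_congr hterm', tsum_mul_left, tsum_weilR_matS hM₀ hM hu,
      det_eq_one_of_isUnit hM₀ hM hu]
    simp
  · rw [cocycle, sign_lowerLeft_matS_iwasawa]
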